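/- Let $\mathbb{T}'=\mathbb{R}\sqcup\mathbb{R}^\nu\sqcup\{\infty\}$ be Izhakian's supertropical semiring (min convention): elements of $\mathbb{R}$ are called tangible, $\infty$ is the neutral element of the sum $\oplus'$; a sum of two elements is the one with smaller underlying real number, and two finite elements with the same underlying real number $a$ add up to $a^\nu$ (in particular $a\oplus' a=a^\nu$); the product $\odot'$ adds underlying real numbers, a product of finite elements being in $\mathbb{R}^\nu$ as soon as one factor is, and $\infty$ is absorbing. An element is called a ghost if it belongs to the ghost ideal $\mathbb{R}^\nu\cup\{\infty\}$. For a supertropical Laurent polynomial $h=\bigoplus'_{i\in A}p_i\odot' w^i$ with $A\subset\mathbb{Z}^d$ finite, a point $q\in\mathbb{R}^d$ lies in $\mathcal{T}'(h)$ if $h(q)$ is a ghost (so the zero polynomial vanishes everywhere). For an integer affine function $L(w)=j_1w_1+\dots+j_dw_d+\beta$ ($j\in\mathbb{Z}^d$, $\beta\in\mathbb{Z}$), the Euler derivative is $\frac{\partial h}{\partial L}=\bigoplus'_{i\in A,\,L(i)\neq 0}p_i\odot' w^i$. Let $A_1,A_2\subset\mathbb{Z}^2$ be finite sets with at least two elements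 each, let $f,g$ be supertropical polynomials in $w_1,w_2$ with supports $A_1,A_2$ and tangible coefficients, and let $q=(q_1,q_2)\in\mathbb{R}^2$ with $q\in\mathcal{T}'(f)\cap\mathcal{T}'(g)$. The point $q$ is called a non-transversal intersection point of $f$ and $g$ if there is $l\in\mathbb{R}$ such that $\frac{\partial (f\oplus' w_3\odot' g)}{\partial L'}(q_1,q_2,l)$ is a ghost for every integer affine function $L'$ in three variables. Exclude the following degenerate situation, and the one obtained from it by exchanging $(A_1,f)$ and $(A_2,g)$: the value $\frac{\partial f}{\partial L}(q)$ is not tangible for any integer affine function $L$, while $\frac{\partial g}{\partial M}(q)$ is tangible for some integer affine function $M$ that is constant on $A_1$. (This can only occur if $A_1$ is contained in a line.) **Theorem.** Under these assumptions, $q$ is a non-transversal intersection point of $f$ and $g$ if and only if for all integer affine functions $L_1,L_2$ in two variables and all $c_1,c_2\in\mathbb{Z}$, the point $q$ lies in the variety of the supertropical polynomial $$\frac{\partial f}{\partial L_1}\odot'\frac{\partial g}{\partial (L_2+c_2)}\ \oplus'\ \frac{\partial f}{\partial L_2}\odot'\frac{\partial g}{\partial (L_1+c_1)},$$ that is, the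 value of this polynomial at $q$ is a ghost. -/

import Mathlib

/-- The extended tropical (supertropical) semiring `𝕋'`, min convention: the disjoint union of the
tangible copy of `ℝ`, the ghost copy `ℝ^ν` of `ℝ`, and the neutral element `∞` of the sum. -/
inductive Supertropical : Type
  | tangible (a : ℝ) : Supertropical
  | ghost (a : ℝ) : Supertropical
  | infty : Supertropical

namespace Supertropical

/-- The sum `⊕'`: the term with the smaller underlying real number wins; two terms with the same
underlying real number `a` add up to the ghost `a^ν`; `∞` is neutral. -/
noncomputable def add : Supertropical → Supertropical → Supertropical
  | infty, y => y
  | x, infty => x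
  | tangible a, tangible b => if a < b then tangible a else if b < a then tangible b else ghost a
  | tangible a, ghost b => if a < b then tangible a else ghost b
  | ghost a, tangible b => if b < a then tangible b else ghost a
  | ghost a, ghost b => ghost (min a b)

/-- The product `⊙'`: underlying real numbers are added; the product is a ghost as soon as one of
the factors is a ghost; `∞` is absorbing. -/
noncomputable def mul : Supertropical → Supertropical → Supertropical
  | infty, _ => infty
  | _, infty => infty
  | tangible a, tangible b => tangible (a + b)
  | tangible a, ghost b => ghost (a + b)
  | ghost a, tangible b => ghost (a + b)
  | ghost a, ghost b => ghost (a + b)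

noncomputable instance : Zero Supertropical := ⟨infty⟩
noncomputable instance : One Supertropical := ⟨tangible 0⟩
noncomputable instance : Add Supertropical := ⟨add⟩
noncomputable instance : Mul Supertropical := ⟨mul⟩

theorem zero_def : (0 : Supertropical) = infty := rfl
theorem one_def : (1 : Supertropical) = tangible 0 := rfl
theorem add_def (x y : Supertropical) : x + y = add x y := rfl
theorem mul_def (x y : Supertropical) : x * y = mul x y := rfl

theorem add_comm' (x y : Supertropical) : x + y = y + x := by
  rcases x with a | a | _ <;> rcases y with b | b | _ <;> simp only [add_def, add] <;> grind

theorem add_assoc' (x y z : Supertropical) : x + y + z = x + (y + z) := by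
  rcases x with a | a | _ <;> rcases y with b | b | _ <;> rcases z with c | c | _ <;>
    simp only [add_def, add] <;> grind [add]

theorem mul_comm' (x y : Supertropical) : x * y = y * x := by
  rcases x with a | a | _ <;> rcases y with b | b | _ <;> simp only [mul_def, mul] <;> grind

theorem mul_assoc' (x y z : Supertropical) : x * y * z = x * (y * z) := by
  rcases x with a | a | _ <;> rcases y with b | b | _ <;> rcases z with c | c | _ <;>
    simp only [mul_def, mul] <;> grind

theorem one_mul' (x : Supertropical) : 1 * x = x := by
  rcases x with a | a | _ <;> simp [one_def, mul_def, mul]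

theorem mul_add' (x y z : Supertropical) : x * (y + z) = x * y + x * z := by
  rcases x with a | a | _ <;> rcases y with b | b | _ <;> rcases z with c | c | _ <;>
    simp only [add_def, add, mul_def, mul] <;> grind [mul]

noncomputable instance : CommSemiring Supertropical where
  add_assoc := add_assoc'
  zero_add _ := rfl
  add_zero x := by rw [add_comm']; rfl
  add_comm := add_comm'
  nsmul := nsmulRec
  mul_assoc := mul_assoc'
  one_mul := one_mul'
  mul_one x := by rw [mul_comm', one_mul']
  mul_comm := mul_comm'
  left_distrib := mul_add'
  right_distrib x y z := by rw [mul_comm', mul_add', mul_comm' z x, mul_comm' z y]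
  zero_mul _ := rfl
  mul_zero x := by rw [mul_comm']; rfl

/-- Tangible elements: those of the first copy of `ℝ`. -/
def IsTangible (x : Supertropical) : Prop := ∃ a : ℝ, x = tangible a

/-- Membership in the ghost ideal `ℝ^ν ∪ {∞}`. The zero element `∞` belongs to the ghost ideal, so
that the zero polynomial vanishes everywhere. -/
def IsGhost (x : Supertropical) : Prop := x = infty ∨ ∃ a : ℝ, x = ghost a

/-- Supertropical (Laurent) polynomials in `d` variables, as formal finite sums of monomials
`p_i ⊙' w^i`, `i ∈ ℤ^d`. Their sum and product are the formal `⊕'` and `⊙'`. -/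
abbrev Poly (d : ℕ) : Type := AddMonoidAlgebra Supertropical (Fin d → ℤ)

/-- The polynomial `⊕'_{i ∈ A} p_i ⊙' w^i` with support `A` and tangible coefficients `p_i`. -/
noncomputable def tangiblePoly {d : ℕ} (A : Finset (Fin d → ℤ)) (p : (Fin d → ℤ) → ℝ) : Poly d :=
  ∑ i ∈ A, AddMonoidAlgebra.single i (tangible (p i))

/-- The value `h(q) = ⊕'_i p_i ⊙' q^i` at a tangible point `q ∈ ℝ^d`, where `q^i` is the tangible
element `⟨i, q⟩`. -/
noncomputable def eval {d : ℕ} (h : Poly d) (q : Fin d → ℝ) : Supertropical :=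
  ∑ i ∈ h.coeff.support, h.coeff i * tangible (∑ k, (i k : ℝ) * q k)

/-- The tangible points of the supertropical variety `𝒯'(h)`. -/
def variety {d : ℕ} (h : Poly d) : Set (Fin d → ℝ) := {q | IsGhost (eval h q)}

/-- An integer affine function `L(w) = j₁ w₁ + … + j_d w_d + β`, with `j ∈ ℤ^d` and `β ∈ ℤ`. -/
structure IntAffine (d : ℕ) where
  lin : Fin d → ℤ
  const : ℤ

namespace IntAffine

/-- The value of an integer affine function at a lattice point. -/
def val {d : ℕ} (L : IntAffine d) (i : Fin d → ℤ) : ℤ := ∑ k, L.lin k * i k + L.const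

/-- The integer affine function `L + c`. -/
def addConst {d : ℕ} (L : IntAffine d) (c : ℤ) : IntAffine d := ⟨L.lin, L.const + c⟩

end IntAffine

/-- The Euler derivative `∂h/∂L`: keep exactly the monomials `i` of `h` with `L(i) ≠ 0`. -/
noncomputable def eulerDeriv {d : ℕ} (L : IntAffine d) (h : Poly d) : Poly d :=
  AddMonoidAlgebra.ofCoeff (h.coeff.filter fun i => L.val i ≠ 0)

/-- A polynomial in `w₁, w₂` viewed as a polynomial in `w₁, w₂, w₃`. -/
noncomputable def toThree (h : Poly 2) : Poly 3 :=
  AddMonoidAlgebra.mapDomain (fun i : Fin 2 → ℤ => (![i 0, i 1, 0] : Fin 3 → ℤ)) h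

/-- The variable `w₃`. -/
noncomputable def w₃ : Poly 3 := AddMonoidAlgebra.single ![0, 0, 1] 1

/-- `q ∈ ℝ²` is a non-transversal intersection point of `f` and `g`: it lies on both curves and
there is `l ∈ ℝ` such that `(q₁, q₂, l)` lies in the variety of `∂(f ⊕' w₃ ⊙' g)/∂L'` for every
integer affine function `L'` in three variables. -/
def IsNonTransversal (f g : Poly 2) (q : Fin 2 → ℝ) : Prop :=
  q ∈ variety f ∩ variety g ∧
    ∃ l : ℝ, ∀ L' : IntAffine 3,
      (![q 0, q 1, l] : Fin 3 → ℝ) ∈ variety (eulerDeriv L' (toThree f + w₃ * toThree g))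

/-- The degenerate situation for an ordered pair `(f, g)`, where `A` is the support of `f`:
no Euler derivative of `f` has a tangible value at `q`, but some Euler derivative of `g` with
respect to an integer affine function that is constant on `A` does. (When `q` lies on the curve of
`g`, this forces `A` to be contained in a line.) -/
def IsDegenerate (A : Finset (Fin 2 → ℤ)) (f g : Poly 2) (q : Fin 2 → ℝ) : Prop :=
  (∀ L : IntAffine 2, ¬ IsTangible (eval (eulerDeriv L f) q)) ∧
    ∃ M : IntAffine 2, (∀ i ∈ A, ∀ j ∈ A, M.val i = M.val j) ∧
      IsTangible (eval (eulerDeriv M g) q)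

end Supertropical

namespace Supertropical

/-! Evaluation is a semiring homomorphism, so for `L'` with restriction `L` to the first two
variables and `w₃`-slope `c`, the derivative of `f ⊕' w₃ ⊙' g` takes at `(q, l)` the value `x + l
y`, where `x` and `y` are the values at `q` of `∂f/∂L` and `∂g/∂(L + c)` (`isNonTransversal_iff`).
Non-transversality thus asks for one real `l` balancing all these pairs.

A tangible `x` requires `y ≠ ∞` and bounds `l` above by `x - y`; a tangible `y` requires `x ≠ ∞` and
bounds `l` below by `x - y` (`isGhost_add_tangible_mul_iff`). Only finitely many pairs occur, so `l`
exists once each lower bound is at most each upper bound and the required values are finite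
(`exists_shift_isGhost`). The product condition gives the inequalities; it also gives finiteness
when the other polynomial has some tangible derivative. Otherwise finiteness comes from excluding
the degenerate situation. -/

/-- The underlying real number of a finite element (and `0` for `∞`). -/
def toReal : Supertropical → ℝ
  | tangible a => a
  | ghost a => a
  | infty => 0

theorem isTangible_mul {x y : Supertropical} (hx : IsTangible x) (hy : IsTangible y) :
    IsTangible (x * y) := by
  obtain ⟨a, rfl⟩ := hx
  obtain ⟨b, rfl⟩ := hy
  exact ⟨a + b, rfl⟩

theorem isTangible_of_mul {x y : Supertropical} (h : IsTangible (x * y)) :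
    IsTangible x ∧ IsTangible y := by
  obtain ⟨a, h⟩ := h
  rcases x with b | b | _ <;> rcases y with c | c | _ <;>
    simp_all [mul_def, mul, IsTangible]

theorem IsTangible.ne_zero {x : Supertropical} (h : IsTangible x) : x ≠ 0 := by
  obtain ⟨a, rfl⟩ := h
  simp [zero_def]

theorem mul_ne_zero_iff' {x y : Supertropical} : x * y ≠ 0 ↔ x ≠ 0 ∧ y ≠ 0 := by
  rcases x with b | b | _ <;> rcases y with c | c | _ <;> simp [mul_def, mul, zero_def]

theorem toReal_mul {x y : Supertropical} (hx : x ≠ 0) (hy : y ≠ 0) :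
    toReal (x * y) = toReal x + toReal y := by
  rcases x with b | b | _ <;> rcases y with c | c | _ <;>
    simp_all [mul_def, mul, zero_def, toReal]

theorem add_eq_zero_iff' {x y : Supertropical} : x + y = 0 ↔ x = 0 ∧ y = 0 := by
  rcases x with a | a | _ <;> rcases y with b | b | _ <;>
    simp only [add_def, add, zero_def] <;> grind

theorem sum_eq_zero_iff' {ι : Type*} (s : Finset ι) (u : ι → Supertropical) :
    ∑ i ∈ s, u i = 0 ↔ ∀ i ∈ s, u i = 0 := by
  classical
  induction s using Finset.induction_on with
  | empty => simp
  | insert i s hi ih => rw [Finset.sum_insert hi, add_eq_zero_iff', ih]; simp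

/-- A sum is a ghost exactly when neither summand is a tangible element that beats the other
one strictly. -/
theorem isGhost_add_iff {x y : Supertropical} :
    IsGhost (x + y) ↔ (IsTangible x → y ≠ 0 ∧ toReal y ≤ toReal x) ∧
      (IsTangible y → x ≠ 0 ∧ toReal x ≤ toReal y) := by
  rcases x with a | a | _ <;> rcases y with b | b | _ <;>
    simp only [add_def, add, zero_def, IsGhost, IsTangible, toReal] <;> grind

/-! ### Evaluation and Euler derivatives -/

/-- The tangible monomials `q^i`, as a monoid homomorphism in the exponent. -/
noncomputable def monomialHom {d : ℕ} (q : Fin d → ℝ) :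
    Multiplicative (Fin d → ℤ) →* Supertropical where
  toFun i := tangible (∑ k, (i.toAdd k : ℝ) * q k)
  map_one' := by simp [one_def]
  map_mul' i j := by simp [mul_def, mul, add_mul, Finset.sum_add_distrib]

/-- Evaluation at a tangible point, as a semiring homomorphism. -/
noncomputable def evalHom {d : ℕ} (q : Fin d → ℝ) : Poly d →+* Supertropical :=
  AddMonoidAlgebra.liftNCRingHom (RingHom.id _) (monomialHom q) fun _ _ => Commute.all _ _

theorem evalHom_single {d : ℕ} (q : Fin d → ℝ) (i : Fin d → ℤ) (a : Supertropical) :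
    evalHom q (AddMonoidAlgebra.single i a) = a * tangible (∑ k, (i k : ℝ) * q k) :=
  AddMonoidAlgebra.liftNC_single _ _ _ _

theorem eval_eq_evalHom {d : ℕ} (h : Poly d) (q : Fin d → ℝ) : eval h q = evalHom q h := by
  conv_rhs => rw [← AddMonoidAlgebra.sum_coeff_single h]
  simp [Finsupp.sum, evalHom_single, eval]

theorem eulerDeriv_add {d : ℕ} (L : IntAffine d) (h k : Poly d) :
    eulerDeriv L (h + k) = eulerDeriv L h + eulerDeriv L k := by
  simp [eulerDeriv, Finsupp.filter_add]

theorem eulerDeriv_zero {d : ℕ} (L : IntAffine d) : eulerDeriv L (0 : Poly d) = 0 :=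
  congrArg AddMonoidAlgebra.ofCoeff (Finsupp.filter_zero fun i => L.val i ≠ 0)

theorem eulerDeriv_single {d : ℕ} (L : IntAffine d) (i : Fin d → ℤ) (a : Supertropical) :
    eulerDeriv L (AddMonoidAlgebra.single i a) =
      if L.val i ≠ 0 then AddMonoidAlgebra.single i a else 0 := by
  split_ifs with h
  · exact congrArg AddMonoidAlgebra.ofCoeff (Finsupp.filter_single_of_pos (fun i => L.val i ≠ 0) h)
  · exact congrArg AddMonoidAlgebra.ofCoeff (Finsupp.filter_single_of_neg (fun i => L.val i ≠ 0) h)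

theorem eval_eulerDeriv {d : ℕ} (L : IntAffine d) (h : Poly d) (q : Fin d → ℝ) :
    eval (eulerDeriv L h) q = ∑ i ∈ h.coeff.support with L.val i ≠ 0,
      h.coeff i * tangible (∑ k, (i k : ℝ) * q k) := by
  simp only [eval, eulerDeriv, AddMonoidAlgebra.coeff_ofCoeff, Finsupp.support_filter]
  refine Finset.sum_congr rfl fun i hi => ?_
  rw [Finsupp.filter_apply_pos (fun i => L.val i ≠ 0) _ (Finset.mem_filter.1 hi).2]

/-- The value depends on `L` only through the set of monomials that survive, a subset of the finite
support. -/
theorem finite_range_eval_eulerDeriv {d : ℕ} (h : Poly d) (q : Fin d → ℝ) :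
    (Set.range fun L : IntAffine d => eval (eulerDeriv L h) q).Finite := by
  refine (h.coeff.support.powerset.finite_toSet.image fun s =>
    ∑ i ∈ s, h.coeff i * tangible (∑ k, (i k : ℝ) * q k)).subset ?_
  rintro _ ⟨L, rfl⟩
  refine ⟨h.coeff.support.filter fun i => L.val i ≠ 0, ?_, (eval_eulerDeriv L h q).symm⟩
  exact Finset.mem_coe.2 (Finset.mem_powerset.2 (Finset.filter_subset _ _))

theorem coeff_tangiblePoly {d : ℕ} {A : Finset (Fin d → ℤ)} (p : (Fin d → ℤ) → ℝ)
    {i : Fin d → ℤ} (hi : i ∈ A) : (tangiblePoly A p).coeff i = tangible (p i) := by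
  classical
  simp [tangiblePoly, AddMonoidAlgebra.coeff_sum, Finsupp.single_apply, hi]

theorem eval_eulerDeriv_tangiblePoly_ne_zero {d : ℕ} {A : Finset (Fin d → ℤ)}
    (p : (Fin d → ℤ) → ℝ) (q : Fin d → ℝ) {L : IntAffine d} {i : Fin d → ℤ} (hi : i ∈ A)
    (hL : L.val i ≠ 0) : eval (eulerDeriv L (tangiblePoly A p)) q ≠ 0 := by
  rw [eval_eulerDeriv, Ne, sum_eq_zero_iff']
  intro h
  have hc := coeff_tangiblePoly p hi
  have := h i (by simp [hc, hL, zero_def])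
  rw [hc] at this
  exact (isTangible_mul ⟨_, rfl⟩ ⟨_, rfl⟩).ne_zero this

theorem IntAffine.val_addConst {d : ℕ} (L : IntAffine d) (c : ℤ) (i : Fin d → ℤ) :
    (L.addConst c).val i = L.val i + c := by
  simp [IntAffine.val, IntAffine.addConst, add_assoc]

/-- If `L` is not constant on the support, no Euler derivative along a translate of `L` is zero. -/
theorem eval_eulerDeriv_addConst_ne_zero {d : ℕ} {A : Finset (Fin d → ℤ)}
    (p : (Fin d → ℤ) → ℝ) (q : Fin d → ℝ) {L : IntAffine d}
    (hL : ¬ ∀ i ∈ A, ∀ j ∈ A, L.val i = L.val j) (c : ℤ) :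
    eval (eulerDeriv (L.addConst c) (tangiblePoly A p)) q ≠ 0 := by
  push Not at hL
  obtain ⟨i, hi, j, hj, hij⟩ := hL
  by_cases h : (L.addConst c).val i = 0
  · refine eval_eulerDeriv_tangiblePoly_ne_zero p q hj fun h' => hij ?_
    rw [IntAffine.val_addConst] at h h'
    omega
  · exact eval_eulerDeriv_tangiblePoly_ne_zero p q hi h

/-! ### Reduction from three variables to two -/

/-- The restriction of a three-variable integer affine function to the plane `w₃ = 0`. -/
def IntAffine.restrict (L : IntAffine 3) : IntAffine 2 := ⟨![L.lin 0, L.lin 1], L.const⟩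

theorem eval_eulerDeriv_toThree (L : IntAffine 3) (f : Poly 2) (q : Fin 2 → ℝ) (l : ℝ) :
    eval (eulerDeriv L (toThree f)) ![q 0, q 1, l] = eval (eulerDeriv L.restrict f) q := by
  simp only [eval_eq_evalHom]
  induction f using AddMonoidAlgebra.induction_linear with
  | zero => simp [toThree, eulerDeriv_zero]
  | add f g hf hg =>
    rw [toThree] at *
    simp only [AddMonoidAlgebra.mapDomain_add, eulerDeriv_add, map_add, ← hf, ← hg]
  | single i a =>
    have hv : L.val ![i 0, i 1, 0] = L.restrict.val i := by
      simp [IntAffine.val, IntAffine.restrict, Fin.sum_univ_succ]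
    simp only [toThree, AddMonoidAlgebra.mapDomain_single, eulerDeriv_single, hv]
    split_ifs
    · simp [evalHom_single, Fin.sum_univ_succ]
    · simp

/-- The exponents of `w₃ ⊙' g` lie at height one, so the `w₃`-slope acts as a translation of the
restricted function. -/
theorem eval_eulerDeriv_w₃_mul_toThree (L : IntAffine 3) (g : Poly 2) (q : Fin 2 → ℝ) (l : ℝ) :
    eval (eulerDeriv L (w₃ * toThree g)) ![q 0, q 1, l] =
      tangible l * eval (eulerDeriv (L.restrict.addConst (L.lin 2)) g) q := by
  simp only [eval_eq_evalHom]
  induction g using AddMonoidAlgebra.induction_linear with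
  | zero => simp [toThree, eulerDeriv_zero]
  | add f g hf hg =>
    rw [toThree] at *
    simp only [AddMonoidAlgebra.mapDomain_add, eulerDeriv_add, map_add, mul_add, ← hf, ← hg]
  | single i a =>
    have hv : L.val (![0, 0, 1] + ![i 0, i 1, 0]) =
        (L.restrict.addConst (L.lin 2)).val i := by
      rw [IntAffine.val_addConst]
      simp [IntAffine.val, IntAffine.restrict, Fin.sum_univ_succ]
      ring
    simp only [toThree, w₃, AddMonoidAlgebra.mapDomain_single, AddMonoidAlgebra.single_mul_single,
      eulerDeriv_single, hv]
    split_ifs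
    · rw [evalHom_single, evalHom_single, one_mul, mul_left_comm]
      congr 1
      simp [Fin.sum_univ_succ, mul_def, mul]
      ring
    · simp

theorem isNonTransversal_iff {f g : Poly 2} {q : Fin 2 → ℝ} (hq : q ∈ variety f ∩ variety g) :
    IsNonTransversal f g q ↔ ∃ l : ℝ, ∀ (L : IntAffine 2) (c : ℤ),
      IsGhost (eval (eulerDeriv L f) q + tangible l * eval (eulerDeriv (L.addConst c) g) q) := by
  rw [IsNonTransversal, and_iff_right hq]
  refine exists_congr fun l => ?_
  have key : ∀ L : IntAffine 3,
      (![q 0, q 1, l] : Fin 3 → ℝ) ∈ variety (eulerDeriv L (toThree f + w₃ * toThree g)) ↔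
        IsGhost (eval (eulerDeriv L.restrict f) q +
          tangible l * eval (eulerDeriv (L.restrict.addConst (L.lin 2)) g) q) := fun L => by
    rw [← eval_eulerDeriv_toThree L f q l, ← eval_eulerDeriv_w₃_mul_toThree L g q l,
      eulerDeriv_add, variety, Set.mem_ofPred_eq]
    simp only [eval_eq_evalHom, map_add]
  simp only [key]
  refine ⟨fun h L c => ?_, fun h L => h _ _⟩
  have hr : IntAffine.restrict ⟨![L.lin 0, L.lin 1, c], L.const⟩ = L := by
    rcases L with ⟨j, β⟩
    simp only [IntAffine.restrict, IntAffine.mk.injEq, and_true]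
    ext k
    fin_cases k <;> rfl
  simpa [hr] using h ⟨![L.lin 0, L.lin 1, c], L.const⟩

/-! ### Existence of a common shift -/

theorem exists_real_between {s t : Set ℝ} (hs : s.Finite) (ht : t.Finite)
    (h : ∀ a ∈ s, ∀ b ∈ t, a ≤ b) : ∃ l, (∀ a ∈ s, a ≤ l) ∧ ∀ b ∈ t, l ≤ b := by
  -- Finiteness matters only when one set is empty and the other must be bounded; otherwise
  -- completeness of `ℝ` suffices.
  rcases s.eq_empty_or_nonempty with rfl | hs'
  · obtain ⟨l, hl⟩ := ht.bddBelow
    exact ⟨l, by simp, fun b hb => hl hb⟩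
  rcases t.eq_empty_or_nonempty with rfl | ht'
  · obtain ⟨l, hl⟩ := hs.bddAbove
    exact ⟨l, fun a ha => hl ha, by simp⟩
  obtain ⟨l, hl, hl'⟩ := exists_between_of_forall_le hs' ht' h
  exact ⟨l, fun a ha => hl ha, fun b hb => hl' hb⟩

theorem isGhost_add_tangible_mul_iff {x y : Supertropical} {l : ℝ} :
    IsGhost (x + tangible l * y) ↔ (IsTangible x → y ≠ 0 ∧ l + toReal y ≤ toReal x) ∧
      (IsTangible y → x ≠ 0 ∧ toReal x ≤ l + toReal y) := by
  rcases x with a | a | _ <;> rcases y with b | b | _ <;>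
    simp [isGhost_add_iff, mul_def, mul, zero_def, IsTangible, toReal]

/-- A finite family of pairs `(x, y)` can be balanced by a common shift `l` of the second
components as soon as the pairs are compatible with each other. -/
theorem exists_shift_isGhost {S : Set (Supertropical × Supertropical)} (hS : S.Finite)
    (hx : ∀ z ∈ S, IsTangible z.1 → z.2 ≠ 0) (hy : ∀ z ∈ S, IsTangible z.2 → z.1 ≠ 0)
    (h : ∀ z ∈ S, ∀ w ∈ S, IsTangible z.1 → IsTangible w.2 →
      toReal w.1 + toReal z.2 ≤ toReal z.1 + toReal w.2) :
    ∃ l, ∀ z ∈ S, IsGhost (z.1 + tangible l * z.2) := by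
  obtain ⟨l, hl, hl'⟩ := exists_real_between
    (((hS.subset (Set.sep_subset S fun z => IsTangible z.2))).image
      fun z => toReal z.1 - toReal z.2)
    (((hS.subset (Set.sep_subset S fun z => IsTangible z.1))).image
      fun z => toReal z.1 - toReal z.2) (by
      rintro _ ⟨w, ⟨hw, hw'⟩, rfl⟩ _ ⟨z, ⟨hz, hz'⟩, rfl⟩
      have := h z hz w hw hz' hw'
      dsimp only
      linarith)
  refine ⟨l, fun z hz => isGhost_add_tangible_mul_iff.2 ⟨fun ht => ⟨hx z hz ht, ?_⟩,
    fun ht => ⟨hy z hz ht, ?_⟩⟩⟩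
  · have := hl' _ ⟨z, ⟨hz, ht⟩, rfl⟩
    dsimp only at this
    linarith
  · have := hl _ ⟨z, ⟨hz, ht⟩, rfl⟩
    dsimp only at this
    linarith

/-- Two balanced pairs are compatible with each other. -/
theorem isGhost_mul_add_mul {x y x' y' : Supertropical} {l : ℝ}
    (h : IsGhost (x + tangible l * y)) (h' : IsGhost (x' + tangible l * y')) :
    IsGhost (x * y' + x' * y) := by
  rw [isGhost_add_tangible_mul_iff] at h h'
  refine isGhost_add_iff.2 ⟨fun ht => ?_, fun ht => ?_⟩
  · obtain ⟨hx, hy'⟩ := isTangible_of_mul ht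
    obtain ⟨h₁, h₂⟩ := h.1 hx
    obtain ⟨h₃, h₄⟩ := h'.2 hy'
    rw [mul_ne_zero_iff', toReal_mul h₃ h₁, toReal_mul hx.ne_zero hy'.ne_zero]
    exact ⟨⟨h₃, h₁⟩, by linarith⟩
  · obtain ⟨hx', hy⟩ := isTangible_of_mul ht
    obtain ⟨h₁, h₂⟩ := h'.1 hx'
    obtain ⟨h₃, h₄⟩ := h.2 hy
    rw [mul_ne_zero_iff', toReal_mul h₃ h₁, toReal_mul hx'.ne_zero hy.ne_zero]
    exact ⟨⟨h₃, h₁⟩, by linarith⟩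

theorem mem_variety_mul_add_mul {d : ℕ} (h₁ h₂ h₃ h₄ : Poly d) (q : Fin d → ℝ) :
    q ∈ variety (h₁ * h₂ + h₃ * h₄) ↔
      IsGhost (eval h₁ q * eval h₂ q + eval h₃ q * eval h₄ q) := by
  simp only [variety, Set.mem_ofPred_eq, eval_eq_evalHom, map_add, map_mul]

theorem IntAffine.addConst_addConst_neg {d : ℕ} (L : IntAffine d) (c : ℤ) :
    (L.addConst c).addConst (-c) = L := by
  simp [IntAffine.addConst]

theorem IntAffine.addConst_zero {d : ℕ} (L : IntAffine d) : L.addConst 0 = L := by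
  simp [IntAffine.addConst]

end Supertropical

open Supertropical in
theorem mainTheorem12
    (A₁ A₂ : Finset (Fin 2 → ℤ)) (hA₁ : 2 ≤ A₁.card) (hA₂ : 2 ≤ A₂.card)
    (p₁ p₂ : (Fin 2 → ℤ) → ℝ) (f g : Supertropical.Poly 2)
    (hf : f = Supertropical.tangiblePoly A₁ p₁) (hg : g = Supertropical.tangiblePoly A₂ p₂)
    (q : Fin 2 → ℝ) (hq : q ∈ Supertropical.variety f ∩ Supertropical.variety g)
    (hfg : ¬ Supertropical.IsDegenerate A₁ f g q)
    (hgf : ¬ Supertropical.IsDegenerate A₂ g f q) :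
    Supertropical.IsNonTransversal f g q ↔
      ∀ (L₁ L₂ : Supertropical.IntAffine 2) (c₁ c₂ : ℤ),
        q ∈ Supertropical.variety
          (Supertropical.eulerDeriv L₁ f * Supertropical.eulerDeriv (L₂.addConst c₂) g +
            Supertropical.eulerDeriv L₂ f * Supertropical.eulerDeriv (L₁.addConst c₁) g) := by
  simp only [isNonTransversal_iff hq, mem_variety_mul_add_mul]
  refine ⟨fun ⟨l, hl⟩ L₁ L₂ c₁ c₂ => isGhost_mul_add_mul (hl L₁ c₁) (hl L₂ c₂), fun H => ?_⟩
  -- If the first product is tangible, it must not beat the second strictly: this compares an upper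
  -- bound on `l` with a lower one and makes both factors of the second product finite.
  have hcomp : ∀ L₁ L₂ c₁ c₂, IsTangible (eval (eulerDeriv L₁ f) q) →
      IsTangible (eval (eulerDeriv (L₂.addConst c₂) g) q) →
      (eval (eulerDeriv L₂ f) q ≠ 0 ∧ eval (eulerDeriv (L₁.addConst c₁) g) q ≠ 0) ∧
        toReal (eval (eulerDeriv L₂ f) q) + toReal (eval (eulerDeriv (L₁.addConst c₁) g) q) ≤
        toReal (eval (eulerDeriv L₁ f) q) + toReal (eval (eulerDeriv (L₂.addConst c₂) g) q) := by
    intro L₁ L₂ c₁ c₂ h₁ h₂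
    obtain ⟨h₃, h₄⟩ := (isGhost_add_iff.1 (H L₁ L₂ c₁ c₂)).1 (isTangible_mul h₁ h₂)
    rw [mul_ne_zero_iff'] at h₃
    rw [toReal_mul h₃.1 h₃.2, toReal_mul h₁.ne_zero h₂.ne_zero] at h₄
    exact ⟨h₃, h₄⟩
  obtain ⟨l, hl⟩ := exists_shift_isGhost
    (S := Set.range fun z : IntAffine 2 × ℤ =>
      (eval (eulerDeriv z.1 f) q, eval (eulerDeriv (z.1.addConst z.2) g) q))
    (((finite_range_eval_eulerDeriv f q).prod (finite_range_eval_eulerDeriv g q)).subset (by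
      rintro _ ⟨z, rfl⟩
      exact ⟨⟨z.1, rfl⟩, ⟨_, rfl⟩⟩))
    (by
      rintro _ ⟨⟨L, c⟩, rfl⟩ ht
      dsimp only at ht ⊢
      -- A tangible derivative of `g` lets `hcomp` apply. If there is none, `hgf` keeps `L` from
      -- being constant on `A₂`, so every translate leaves a monomial of `g`.
      by_cases hex : ∃ M : IntAffine 2, IsTangible (eval (eulerDeriv M g) q)
      · obtain ⟨M, hM⟩ := hex
        exact (hcomp L M c 0 ht (by rwa [IntAffine.addConst_zero])).1.2
      · rw [hg]
        exact eval_eulerDeriv_addConst_ne_zero p₂ q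
          (fun hc => hgf ⟨not_exists.1 hex, L, hc, ht⟩) c)
    (by
      rintro _ ⟨⟨L, c⟩, rfl⟩ ht
      dsimp only at ht ⊢
      by_cases hex : ∃ M : IntAffine 2, IsTangible (eval (eulerDeriv M f) q)
      · obtain ⟨M, hM⟩ := hex
        exact (hcomp M L 0 c hM ht).1.1
      -- The tangible derivative of `g` is along `L + c`, so the exclusion concerns that translate;
      -- shifting by `-c` returns to `L`.
      · have := eval_eulerDeriv_addConst_ne_zero p₁ q
          (fun hc => hfg ⟨not_exists.1 hex, L.addConst c, hc, ht⟩) (-c)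
        rwa [IntAffine.addConst_addConst_neg, ← hf] at this)
    (by
      rintro _ ⟨⟨L₁, c₁⟩, rfl⟩ _ ⟨⟨L₂, c₂⟩, rfl⟩ h₁ h₂
      exact (hcomp L₁ L₂ c₁ c₂ h₁ h₂).2)
  exact ⟨l, fun L c => hl _ ⟨(L, c), rfl⟩⟩
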